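/- All Hilbert spaces are complex, with inner products linear in the first variable. For operators $S,R$ with domains that are linear manifolds, $SR$ has domain $\{x\in\operatorname{Dom}R: Rx\in\operatorname{Dom}S\}$, and equality of operators includes equality of domains. A Hilbert space $\mathcal K$ is *closely embedded* in a Hilbert space $\mathcal H$, with *closed embedding* $j$, if some linear manifold $\mathcal D\subseteq\mathcal K\cap\mathcal H$ (on which the two linear structures agree) is dense in $\mathcal K$ and the identity $j\colon\mathcal D\to\mathcal H$, with $\operatorname{Dom}(j)=\mathcal D\subseteq\mathcal K$, is closed as an operator from $\mathcal K$ to $\mathcal H$. Its *kernel operator* is $jj^*$. For a closed operator $T$ from $\mathcal H$ to $\mathcal G$, let $\mathcal D(T)$ be the Hilbert space completion of $\operatorname{Dom}(T)\ominus\ker T$ under the inner product $(x,y)_T=\langle Tx,Ty\rangle_{\mathcal G}$, with norm $|x|_T=\|Tx\|$, and let $i_T$, with domain $\operatorname{Dom}(T)\ominus\ker T\subseteq\mathcal D(T)$ and values in $\mathcal H$, be $i_Tx=x$. For a closed operator $S$ from $\mathcal G$ to $\mathcal H$, let $\mathcal R(S)$ be the Hilbert space completion of $\operatorname{Ran}(S)$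 under the inner product $\langle Sx,Sy\rangle_S=\langle x,y\rangle_{\mathcal G}$ for $x,y\in\operatorname{Dom}(S)$ orthogonal to $\ker S$, with norm $\|\cdot\|_S$, and let $j_S$, with domain $\operatorname{Ran}(S)\subseteq\mathcal R(S)$ and values in $\mathcal H$, be $j_Su=u$. **Theorem 4.1.** Let $H$ be a positive selfadjoint operator in the Hilbert space $\mathcal H$ with trivial null space. Let $T$ be a closed, densely defined operator from $\mathcal H$ to a Hilbert space $\mathcal G$ such that $\operatorname{Ran}(T)$ is dense in $\mathcal G$ and $H=T^*T$. Then: (i) $\mathcal D(T)$ is closely embedded in $\mathcal H$ with closed embedding $i_T$, whose range is dense in $\mathcal H$, and its kernel operator $A=i_Ti_T^*$ equals $H^{-1}$. (ii) $\mathcal H$ is closely embedded in $\mathcal R(T^*)$ with closed embedding $j_{T^*}^{-1}$, whose range is dense in $\mathcal R(T^*)$, and its kernel operator $B=j_{T^*}^{-1}(j_{T^*}^{-1})^*$ is unitarily equivalent to $A=H^{-1}$. (iii) $\operatorname{Ran}(T^*)\subseteq\operatorname{Dom}(i_T^*)$, and $i_T^*|\operatorname{Ran}(T^*)$, viewed as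 an operator from $\mathcal R(T^*)$ to $\mathcal D(T)$, extends uniquely to a unitary operator $\widetilde A\colon\mathcal R(T^*)\to\mathcal D(T)$. Moreover $\operatorname{Dom}(A)\subseteq\operatorname{Ran}(T^*)$, $\operatorname{Ran}(A)\subseteq\operatorname{Dom}(T)$, and $\widetilde A$ is also the unique unitary extension of $A$ viewed as an operator from $\mathcal R(T^*)$ to $\mathcal D(T)$. (iv) $\operatorname{Dom}(H)\subseteq\operatorname{Dom}(T)$ and $\operatorname{Ran}(H)\subseteq\operatorname{Ran}(T^*)$; viewed as an operator from $\mathcal D(T)$ to $\mathcal R(T^*)$, $H$ has dense domain and dense range, is isometric, and extends uniquely to a unitary operator $\widetilde H\colon\mathcal D(T)\to\mathcal R(T^*)$; and $\widetilde H=\widetilde A^{-1}$. (v) There are a unique unitary operator $V_T\colon\mathcal G\to\mathcal D(T)$ with $T^{-1}=i_TV_T$ and a unique unitary operator $U_{T^*}\colon\mathcal G\to\mathcal R(T^*)$ with $T^*=j_{T^*}U_{T^*}$, and $\widetilde H=U_{T^*}V_T^{-1}$. (vi) The operator $\Theta\colon\mathcal R(T^*)\to\mathcal D(T)^*$, $(\Theta\alpha)(x)=(\widetilde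 A\alpha,x)_T$ for $\alpha\in\mathcal R(T^*)$, $x\in\mathcal D(T)$, is unitary (a surjective linear isometry) onto the conjugate dual space $\mathcal D(T)^*$ of bounded conjugate linear functionals on $\mathcal D(T)$; and for all $y\in\operatorname{Ran}(T^*)$ $$\|y\|_{T^*}=\sup\Bigl\{\frac{|\langle y,x\rangle_{\mathcal H}|}{|x|_T}\ \Big|\ x\in\operatorname{Dom}(T)\setminus\{0\}\Bigr\},$$ where the supremum is finite, and is read as $0$ if $\mathcal H=\{0\}$. -/

import Mathlib

noncomputable section

namespace CloseEmb

open scoped LinearPMap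

/-! ### Unbounded operators

An operator with domain a linear manifold of `E` and values in `F` is a `LinearPMap`.  Equality of
operators includes equality of domains, and `S ≤ R` means that `R` extends `S`. -/

section Operators

variable {E F K : Type*} [AddCommGroup E] [Module ℂ E] [AddCommGroup F] [Module ℂ F]
  [AddCommGroup K] [Module ℂ K]

/-- The product `S R` of unbounded operators, with domain `{x ∈ Dom R | R x ∈ Dom S}`. -/
def prod (S : F →ₗ.[ℂ] K) (R : E →ₗ.[ℂ] F) : E →ₗ.[ℂ] K :=
  S.comp (R.domRestrict ((S.domain.comap R.toFun).map R.domain.subtype)) (by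
    rintro ⟨x, hx⟩
    obtain ⟨y, hy, hyx⟩ := (Submodule.mem_inf.1 hx).1
    have h : R.domRestrict ((S.domain.comap R.toFun).map R.domain.subtype) ⟨x, hx⟩ = R y :=
      LinearPMap.domRestrict_apply hyx.symm
    exact Set.mem_of_eq_of_mem h hy)

/-- The range of an unbounded operator. -/
def ran (R : E →ₗ.[ℂ] F) : Submodule ℂ F := LinearMap.range R.toFun

/-- The null space of an unbounded operator, as a subspace of the ambient space. -/
def null (R : E →ₗ.[ℂ] F) : Submodule ℂ E := (LinearMap.ker R.toFun).map R.domain.subtype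

theorem mem_graph_prod {S : F →ₗ.[ℂ] K} {R : E →ₗ.[ℂ] F} {x : E} {z : K} :
    (x, z) ∈ (prod S R).graph ↔ ∃ y, (x, y) ∈ R.graph ∧ (y, z) ∈ S.graph := by
  constructor
  · intro h
    obtain ⟨⟨x', hx⟩, rfl, rfl⟩ := (LinearPMap.mem_graph_iff _).1 h
    obtain ⟨y, hy, rfl⟩ := (Submodule.mem_inf.1 hx).1
    have h1 : R.domRestrict ((S.domain.comap R.toFun).map R.domain.subtype) ⟨_, hx⟩ = R y :=
      LinearPMap.domRestrict_apply rfl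
    refine ⟨R y, R.mem_graph y, ?_⟩
    have h2 : prod S R ⟨_, hx⟩ = S ⟨R y, hy⟩ := congrArg S (Subtype.ext h1)
    rw [h2]
    exact S.mem_graph ⟨R y, hy⟩
  · rintro ⟨y, h1, h2⟩
    obtain ⟨x', rfl, hx'⟩ := (LinearPMap.mem_graph_iff _).1 h1
    obtain ⟨y', hy', rfl⟩ := (LinearPMap.mem_graph_iff _).1 h2
    obtain rfl : (y' : F) = y := hy'
    have hd : R x' ∈ S.domain := by
      rw [show R x' = y' from hx']
      exact y'.2
    have hx : (x' : E) ∈ (prod S R).domain := ⟨⟨x', hd, rfl⟩, x'.2⟩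
    refine (LinearPMap.mem_graph_iff _).2 ⟨⟨x', hx⟩, rfl, ?_⟩
    exact congrArg S (Subtype.ext ((LinearPMap.domRestrict_apply rfl).trans hx'))

end Operators

section Hilbert

variable {E F : Type*} [NormedAddCommGroup E] [InnerProductSpace ℂ E]
  [NormedAddCommGroup F] [InnerProductSpace ℂ F]

/-- A unitary operator `W : E → F`, regarded as an everywhere defined unbounded operator. -/
def ofUnitary (W : E ≃ₗᵢ[ℂ] F) : E →ₗ.[ℂ] F := (W.toLinearEquiv : E →ₗ[ℂ] F).toPMap ⊤

/-- `W` is the unique unitary operator that extends the operator `S`. -/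
def IsUniqueUnitaryExtension (S : E →ₗ.[ℂ] F) (W : E ≃ₗᵢ[ℂ] F) : Prop :=
  S ≤ ofUnitary W ∧ ∀ W' : E ≃ₗᵢ[ℂ] F, S ≤ ofUnitary W' → W' = W

/-- `R = W S W⁻¹` for some unitary operator `W : E → F` (equality of unbounded operators). -/
def UnitarilyEquivalent (S : E →ₗ.[ℂ] E) (R : F →ₗ.[ℂ] F) : Prop :=
  ∃ W : E ≃ₗᵢ[ℂ] F, R = prod (ofUnitary W) (prod S (ofUnitary W.symm))

/-- The operator `j`, with domain in `E` and values in `F`, is the closed embedding of a Hilbert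
space `E` closely embedded in `F`: it identifies a linear manifold, dense in `E`, with a linear
manifold of `F` (so that the manifold lies in both spaces and `j` acts on it as the identity),
and it is a closed operator. -/
structure IsCloseEmbedding (j : E →ₗ.[ℂ] F) : Prop where
  dense_domain : Dense (j.domain : Set E)
  injective : Function.Injective j
  isClosed : j.IsClosed

/-- The kernel operator `j j*` of the closed embedding `j`. -/
def kernelOperator [CompleteSpace E] (j : E →ₗ.[ℂ] F) : F →ₗ.[ℂ] F := prod j (j†)

end Hilbert

/-! ### Pulling an inner product back along a linear map -/

section Pullback

variable {V E : Type*} [AddCommGroup V] [Module ℂ V] [NormedAddCommGroup E] [InnerProductSpace ℂ E]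

/-- The vector space `V`, to be endowed with the inner product `⟨f x, f y⟩`. -/
def Pullback (_f : V →ₗ[ℂ] E) : Type _ := V

instance (f : V →ₗ[ℂ] E) : AddCommGroup (Pullback f) := inferInstanceAs (AddCommGroup V)

instance (f : V →ₗ[ℂ] E) : Module ℂ (Pullback f) := inferInstanceAs (Module ℂ V)

/-- The inner product `⟨f x, f y⟩` on `V`. -/
abbrev pullbackCore (f : V →ₗ[ℂ] E) : PreInnerProductSpace.Core ℂ (Pullback f) where
  inner x y := inner ℂ (f x) (f y)
  conj_inner_symm x y := inner_conj_symm (f x) (f y)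
  re_inner_nonneg x := inner_self_nonneg (𝕜 := ℂ) (x := f x)
  add_left x y z := (congrArg (fun u => inner ℂ u (f z)) (f.map_add x y)).trans
    (inner_add_left (f x) (f y) (f z))
  smul_left x y c := (congrArg (fun u => inner ℂ u (f y)) (f.map_smul c x)).trans
    (inner_smul_left (f x) (f y) c)

instance (f : V →ₗ[ℂ] E) : SeminormedAddCommGroup (Pullback f) :=
  InnerProductSpace.Core.toSeminormedAddCommGroup (c := pullbackCore f)

instance (f : V →ₗ[ℂ] E) : InnerProductSpace ℂ (Pullback f) :=
  InnerProductSpace.ofCore (pullbackCore f)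

/-- The canonical map of `V` into its completion with respect to the norm `‖f x‖`. -/
def toCompletion (f : V →ₗ[ℂ] E) : V →ₗ[ℂ] UniformSpace.Completion (Pullback f) :=
  (UniformSpace.Completion.toComplL (𝕜 := ℂ) (E := Pullback f)).toLinearMap

theorem inner_toCompletion (f : V →ₗ[ℂ] E) (x y : V) :
    inner ℂ (toCompletion f x) (toCompletion f y) = inner ℂ (f x) (f y) :=
  UniformSpace.Completion.inner_coe (𝕜 := ℂ) (E := Pullback f) x y

end Pullback

/-! ### The spaces `𝓓(T)` and `𝓡(T)` -/

section Spaces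

variable {E F : Type*} [NormedAddCommGroup E] [InnerProductSpace ℂ E]
  [NormedAddCommGroup F] [InnerProductSpace ℂ F]

/-- The linear manifold `Dom(T) ⊖ ker(T)`. -/
def domMinusKer (T : E →ₗ.[ℂ] F) : Submodule ℂ E := T.domain ⊓ (null T)ᗮ

/-- The restriction of `T` to `Dom(T) ⊖ ker(T)`. -/
def dMap (T : E →ₗ.[ℂ] F) : domMinusKer T →ₗ[ℂ] F :=
  T.toFun ∘ₗ Submodule.inclusion inf_le_left

/-- The Hilbert space `𝓓(T)`: the completion of `Dom(T) ⊖ ker(T)` with respect to the inner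
product `(x, y)_T = ⟨T x, T y⟩`. -/
abbrev DSpace (T : E →ₗ.[ℂ] F) : Type _ := UniformSpace.Completion (Pullback (dMap T))

/-- The operator `i_T` with domain `Dom(T) ⊖ ker(T)`, regarded as a linear manifold of `𝓓(T)`,
and values in `E`, acting as the identity. -/
def iEmb (T : E →ₗ.[ℂ] F) : DSpace T →ₗ.[ℂ] E :=
  (LinearMap.range (LinearMap.prod (toCompletion (dMap T)) (domMinusKer T).subtype)).toLinearPMap

theorem ker_le_ker_starProjection [CompleteSpace E] (T : E →ₗ.[ℂ] F) :
    LinearMap.ker T.toFun ≤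
      LinearMap.ker (((null T)ᗮ.starProjection : E →ₗ[ℂ] E) ∘ₗ T.domain.subtype) := by
  intro x hx
  have h : (x : E) ∈ null T := ⟨x, hx, rfl⟩
  exact (Submodule.starProjection_apply_eq_zero_iff _).2 (Submodule.le_orthogonal_orthogonal _ h)

/-- The map that sends `u = T x ∈ Ran(T)`, with `x ∈ Dom(T)`, to the component of `x` orthogonal to
`ker(T)`; if `ker(T)` is closed, this is the only preimage of `u` that is orthogonal to `ker(T)`. -/
def rMap [CompleteSpace E] (T : E →ₗ.[ℂ] F) : ran T →ₗ[ℂ] E :=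
  (LinearMap.ker T.toFun).liftQ
      (((null T)ᗮ.starProjection : E →ₗ[ℂ] E) ∘ₗ T.domain.subtype) (ker_le_ker_starProjection T) ∘ₗ
    T.toFun.quotKerEquivRange.symm.toLinearMap

/-- The Hilbert space `𝓡(T)`: the completion of `Ran(T)` with respect to the inner product
`⟨T x, T y⟩_T = ⟨x, y⟩`, where `x, y ∈ Dom(T)` are orthogonal to `ker(T)`. -/
abbrev RSpace [CompleteSpace E] (T : E →ₗ.[ℂ] F) : Type _ :=
  UniformSpace.Completion (Pullback (rMap T))

/-- The operator `j_T` with domain `Ran(T)`, regarded as a linear manifold of `𝓡(T)`, and values in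
`F`, acting as the identity. -/
def jEmb [CompleteSpace E] (T : E →ₗ.[ℂ] F) : RSpace T →ₗ.[ℂ] F :=
  (LinearMap.range (LinearMap.prod (toCompletion (rMap T)) (ran T).subtype)).toLinearPMap

theorem rMap_apply [CompleteSpace E] (T : E →ₗ.[ℂ] F) (x : T.domain) (h : T x ∈ ran T) :
    rMap T ⟨T x, h⟩ = (null T)ᗮ.starProjection (x : E) :=
  congrArg (Submodule.liftQ _ _ (ker_le_ker_starProjection T))
    (T.toFun.quotKerEquivRange_symm_apply_image x h)

/-- For `x ∈ Dom(T)` orthogonal to `ker(T)`, the preimage of `T x` chosen by `rMap T` is `x`. -/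
theorem rMap_apply_of_mem [CompleteSpace E] (T : E →ₗ.[ℂ] F) (x : T.domain)
    (hx : (x : E) ∈ (null T)ᗮ) (h : T x ∈ ran T) : rMap T ⟨T x, h⟩ = x :=
  (rMap_apply T x h).trans (Submodule.starProjection_eq_self_iff.2 hx)

/-- `i_T` acts as the identity on `Dom(T) ⊖ ker(T)`. -/
theorem mem_graph_iEmb (T : E →ₗ.[ℂ] F) {z : DSpace T} {y : E} :
    (z, y) ∈ (iEmb T).graph ↔ ∃ x : domMinusKer T, toCompletion (dMap T) x = z ∧ x = y := by
  rw [iEmb, Submodule.toLinearPMap_graph_eq]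
  · simp [Prod.ext_iff]
  · rintro _ ⟨x, rfl⟩ (h : toCompletion (dMap T) x = 0)
    have h1 : dMap T x = 0 := by
      rw [← inner_self_eq_zero (𝕜 := ℂ), ← inner_toCompletion, h, inner_zero_left]
    have h2 : (x : E) ∈ null T := ⟨⟨x, x.2.1⟩, h1, rfl⟩
    exact inner_self_eq_zero.1 (x.2.2 x h2)

/-- `j_T` acts as the identity on `Ran(T)`. -/
theorem mem_graph_jEmb [CompleteSpace E] (T : E →ₗ.[ℂ] F) (hT : IsClosed (null T : Set E))
    {z : RSpace T} {y : F} :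
    (z, y) ∈ (jEmb T).graph ↔ ∃ u : ran T, toCompletion (rMap T) u = z ∧ u = y := by
  rw [jEmb, Submodule.toLinearPMap_graph_eq]
  · simp [Prod.ext_iff]
  · rintro _ ⟨⟨_, x, rfl⟩, rfl⟩ (h : toCompletion (rMap T) ⟨T x, _⟩ = 0)
    have h1 : rMap T ⟨T x, x, rfl⟩ = 0 := by
      rw [← inner_self_eq_zero (𝕜 := ℂ), ← inner_toCompletion, h, inner_zero_left]
    replace h1 := (rMap_apply T x ⟨x, rfl⟩).symm.trans h1
    have h3 : (x : E) ∈ (null T)ᗮᗮ := (Submodule.starProjection_apply_eq_zero_iff _).1 h1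
    rw [Submodule.orthogonal_orthogonal_eq_closure, hT.submodule_topologicalClosure_eq] at h3
    obtain ⟨x', hx', h4⟩ := h3
    rw [← (Subtype.ext h4 : x' = x)]
    exact hx'

end Spaces

end CloseEmb

end

noncomputable section

namespace CloseEmb

open scoped LinearPMap

/-! ### Calculus of graphs -/

section Graph

variable {E F : Type*} [AddCommGroup E] [Module ℂ E] [AddCommGroup F] [Module ℂ F]

/-! Since `H = T* T` is injective, so is `T`. Hence `T x ↦ x` extends to a unitary `V` from `𝓖` onto
`𝓓(T)` with `i_T = T⁻¹ V⁻¹`. Likewise `T*` is injective because `Ran(T)` is dense, and densely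
defined because `T` is closed, so `y ↦ T* y` extends to a unitary `U` from `𝓖` onto `𝓡(T*)` with
`j_{T*} = T* U⁻¹`. After these substitutions, recorded in `Factorizes`, the operators of the theorem
are words in `T`, `T*`, `U`, `V`: the kernel operators are `(T* T)⁻¹` and `U (T T*)⁻¹ U⁻¹`, and the
two unitary extensions are `V U⁻¹` and `U V⁻¹`. Working with graphs makes equality of domains
automatic.

Two facts remain, both in `dense_and_exists_unitary_intertwining`: `T` maps `Dom(T* T)` onto a dense
subspace, and `T* T` is unitarily equivalent to `T T*`. They follow from bounded operators alone.
The orthogonal projection onto the graph of `T` has blocks `R = (1 + T* T)⁻¹`, `C = T R`, `C*` and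
`Q = 1 - (1 + T T*)⁻¹`. The operator `C` is injective with dense range, and the unitary factor of
its polar decomposition intertwines `R` with `1 - Q`, hence `T* T` with `T T*`. -/

theorem eq_of_mem_graph_iff {S R : E →ₗ.[ℂ] F}
    (h : ∀ x y, (x, y) ∈ S.graph ↔ (x, y) ∈ R.graph) : S = R :=
  LinearPMap.eq_of_eq_graph (Submodule.ext fun p => h p.1 p.2)

theorem le_of_mem_graph_imp {S R : E →ₗ.[ℂ] F}
    (h : ∀ x y, (x, y) ∈ S.graph → (x, y) ∈ R.graph) : S ≤ R :=
  LinearPMap.le_of_le_graph fun p => h p.1 p.2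

theorem mem_domain_iff_exists {S : E →ₗ.[ℂ] F} {x : E} :
    x ∈ S.domain ↔ ∃ y, (x, y) ∈ S.graph :=
  ⟨fun hx => ⟨S ⟨x, hx⟩, S.mem_graph ⟨x, hx⟩⟩, fun ⟨_, h⟩ => LinearPMap.mem_domain_of_mem_graph h⟩

theorem mem_ran_iff_exists {S : E →ₗ.[ℂ] F} {y : F} :
    y ∈ ran S ↔ ∃ x, (x, y) ∈ S.graph := by
  constructor
  · rintro ⟨x, rfl⟩
    exact ⟨x, S.mem_graph x⟩
  · rintro ⟨x, h⟩
    obtain ⟨x', -, h2⟩ := (LinearPMap.mem_graph_iff _).1 h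
    exact ⟨x', h2⟩

theorem ker_eq_bot_iff_graph {S : E →ₗ.[ℂ] F} :
    LinearMap.ker S.toFun = ⊥ ↔ ∀ x, (x, (0 : F)) ∈ S.graph → x = 0 := by
  rw [LinearMap.ker_eq_bot']
  constructor
  · intro h x hx
    obtain ⟨x', rfl, h2⟩ := (LinearPMap.mem_graph_iff _).1 hx
    rw [h x' h2, Submodule.coe_zero]
  · intro h x hx
    refine Subtype.ext (h x ?_)
    rw [← hx]
    exact S.mem_graph x

theorem mem_graph_inverse {S : E →ₗ.[ℂ] F} (hS : LinearMap.ker S.toFun = ⊥) {x : E} {y : F} :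
    (y, x) ∈ S.inverse.graph ↔ (x, y) ∈ S.graph := by
  rw [LinearPMap.inverse_graph hS]
  constructor
  · rintro ⟨⟨a, b⟩, h, h2⟩
    obtain ⟨rfl, rfl⟩ := Prod.mk.inj h2
    exact h
  · intro h
    exact ⟨(x, y), h, rfl⟩

theorem mem_graph_sub {S : E →ₗ.[ℂ] F} {x x' : E} {y y' : F} (h : (x, y) ∈ S.graph)
    (h' : (x', y') ∈ S.graph) : (x - x', y - y') ∈ S.graph :=
  S.graph.sub_mem h h'

theorem graph_injective {S : E →ₗ.[ℂ] F} (hS : LinearMap.ker S.toFun = ⊥) {x x' : E} {y : F}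
    (h : (x, y) ∈ S.graph) (h' : (x', y) ∈ S.graph) : x = x' := by
  have := mem_graph_sub h h'
  rw [sub_self] at this
  exact sub_eq_zero.1 (ker_eq_bot_iff_graph.1 hS _ this)

end Graph

/-! ### Adjoints, the graph projection and the bounded polar decomposition -/

section Adjoint

variable {E F : Type*} [NormedAddCommGroup E] [InnerProductSpace ℂ E]
  [NormedAddCommGroup F] [InnerProductSpace ℂ F]

theorem mem_graph_ofUnitary {W : E ≃ₗᵢ[ℂ] F} {x : E} {y : F} :
    (x, y) ∈ (ofUnitary W).graph ↔ W x = y := by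
  rw [LinearPMap.mem_graph_iff]
  constructor
  · rintro ⟨x', rfl, h⟩
    exact h
  · intro h
    exact ⟨⟨x, trivial⟩, rfl, h⟩

variable [CompleteSpace E]

theorem mem_graph_adjoint {S : E →ₗ.[ℂ] F} (hS : Dense (S.domain : Set E)) {y : F} {w : E} :
    (y, w) ∈ S†.graph ↔ ∀ x z, (x, z) ∈ S.graph → inner ℂ z y = inner ℂ x w := by
  rw [LinearPMap.adjoint_graph_eq_graph_adjoint hS, Submodule.mem_adjoint_iff]
  simp only [sub_eq_zero]

/-- The null space of the adjoint of an operator with dense range is trivial. -/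
theorem ker_adjoint_eq_bot {S : E →ₗ.[ℂ] F} (hS : Dense (S.domain : Set E))
    (hr : Dense (ran S : Set F)) : LinearMap.ker (S†).toFun = ⊥ := by
  refine ker_eq_bot_iff_graph.2 fun y hy => hr.eq_zero_of_inner_right ℂ fun z hz => ?_
  obtain ⟨x, hx⟩ := mem_ran_iff_exists.1 hz
  rw [(mem_graph_adjoint hS).1 hy x z hx, inner_zero_right]

variable [CompleteSpace F]

/-- The orthogonal projection onto the graph of a closed operator, as a block matrix. -/
theorem exists_graph_projection {T : E →ₗ.[ℂ] F} (hc : T.IsClosed)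
    (hd : Dense (T.domain : Set E)) :
    ∃ (R : E →L[ℂ] E) (C : E →L[ℂ] F) (C' : F →L[ℂ] E) (Q : F →L[ℂ] F), ∀ a b u p,
      (R a + C' b = u ∧ C a + Q b = p) ↔ (u, p) ∈ T.graph ∧ (b - p, u - a) ∈ T†.graph := by
  -- The plain product carries the sup norm; orthogonal projection needs its `L²` version.
  let e := WithLp.prodContinuousLinearEquiv 2 ℂ E F
  let G : Submodule ℂ (WithLp 2 (E × F)) := T.graph.comap (e : WithLp 2 (E × F) →ₗ[ℂ] E × F)
  have hG : _root_.IsClosed (G : Set (WithLp 2 (E × F))) := hc.preimage e.continuous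
  have : CompleteSpace G := hG.completeSpace_coe
  let P : E × F →L[ℂ] E × F := (e : _ →L[ℂ] _) ∘L G.starProjection ∘L (e.symm : _ →L[ℂ] _)
  refine ⟨.fst ℂ E F ∘L P ∘L .inl ℂ E F, .snd ℂ E F ∘L P ∘L .inl ℂ E F,
    .fst ℂ E F ∘L P ∘L .inr ℂ E F, .snd ℂ E F ∘L P ∘L .inr ℂ E F, fun a b u p => ?_⟩
  have h1 : P (a, b) = P (a, 0) + P (0, b) := by rw [← map_add]; simp
  have h2 : P (a, b) = (u, p) ↔ G.starProjection (e.symm (a, b)) = e.symm (u, p) := by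
    rw [← e.symm_apply_apply (G.starProjection _), e.symm.injective.eq_iff]; rfl
  have h3 : G.starProjection (e.symm (a, b)) = e.symm (u, p) ↔
      e.symm (u, p) ∈ G ∧ e.symm (a, b) - e.symm (u, p) ∈ Gᗮ := by
    constructor
    · intro h
      rw [← h]
      exact ⟨Submodule.starProjection_apply_mem _ _, Submodule.sub_starProjection_mem_orthogonal _⟩
    · rintro ⟨h, h'⟩
      exact Submodule.eq_starProjection_of_mem_of_inner_eq_zero h
        (fun w hw => Submodule.inner_left_of_mem_orthogonal hw h')
  -- The orthogonal complement of the graph of `T` is the graph of `T*` with coordinates swapped and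
  -- one sign changed.
  have h4 : e.symm (a, b) - e.symm (u, p) ∈ Gᗮ ↔ (b - p, u - a) ∈ T†.graph := by
    rw [mem_graph_adjoint hd, Submodule.mem_orthogonal]
    constructor
    · intro h x z hxz
      have := h (e.symm (x, z)) (by simpa [G] using hxz)
      rw [← map_sub] at this
      have h5 : inner ℂ x (a - u) + inner ℂ z (b - p) = 0 := this
      rw [← neg_sub a u, inner_neg_right]
      exact eq_neg_of_add_eq_zero_right h5
    · intro h w hw
      have h5 := h (e w).1 (e w).2 hw
      rw [← neg_sub a u, inner_neg_right] at h5
      rw [← map_sub]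
      change inner ℂ (e w).1 (a - u) + inner ℂ (e w).2 (b - p) = 0
      rw [h5, add_neg_cancel]
  rw [← h4]
  have h6 : e.symm (u, p) ∈ G ↔ (u, p) ∈ T.graph := by simp [G]
  rw [← h6, ← h3, ← h2, h1]
  rw [Prod.ext_iff]
  rfl

/-- Every vector of the product space is the sum of its components in the graph of `T` and in the
orthogonal complement of this graph. -/
theorem exists_graph_decomposition {T : E →ₗ.[ℂ] F} (hc : T.IsClosed)
    (hd : Dense (T.domain : Set E)) (a : E) (b : F) :
    ∃ u p v q, (u, p) ∈ T.graph ∧ (v, q) ∈ T†.graph ∧ a = u - q ∧ b = p + v := by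
  obtain ⟨R, C, C', Q, h⟩ := exists_graph_projection hc hd
  obtain ⟨h1, h2⟩ := (h a b _ _).1 ⟨rfl, rfl⟩
  exact ⟨_, _, _, _, h1, h2, by abel, by abel⟩

/-- For `y` orthogonal to `Dom(T*)`, splitting `(0, y)` along the graph gives `y = T u + v` with `u
= T* v`. Then `0 = ⟨v, y⟩ = ‖u‖² + ‖v‖²`, so `y = 0`. -/
theorem dense_domain_adjoint {T : E →ₗ.[ℂ] F} (hc : T.IsClosed)
    (hd : Dense (T.domain : Set E)) : Dense (T†.domain : Set F) := by
  rw [Submodule.dense_iff_topologicalClosure_eq_top, Submodule.topologicalClosure_eq_top_iff,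
    Submodule.eq_bot_iff]
  intro y hy
  obtain ⟨u, p, v, q, h1, h2, h3, rfl⟩ := exists_graph_decomposition hc hd 0 y
  obtain rfl : u = q := sub_eq_zero.1 h3.symm
  have h4 : inner ℂ v (p + v) = 0 := hy v (mem_domain_iff_exists.2 ⟨_, h2⟩)
  have h5 := (mem_graph_adjoint hd).1 h2 _ _ h1
  have h6 : inner ℂ v p = inner ℂ u u := by
    rw [← inner_conj_symm, h5, inner_conj_symm]
  rw [inner_add_right, h6] at h4
  have h7 : ‖u‖ ^ 2 + ‖v‖ ^ 2 = 0 := by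
    have := congrArg RCLike.re h4
    rwa [map_add, inner_self_eq_norm_sq, inner_self_eq_norm_sq, map_zero] at this
  have hv : v = 0 := norm_eq_zero.1 (by nlinarith [sq_nonneg ‖u‖, sq_nonneg ‖v‖])
  have hu : u = 0 := norm_eq_zero.1 (by nlinarith [sq_nonneg ‖u‖, sq_nonneg ‖v‖])
  subst hv hu
  rw [add_zero]
  exact T.graph_fst_eq_zero_snd h1 rfl

/-- If `(x, y)` in the graph of `T**` has component `(-q, v)` orthogonal to the graph of `T`, with
`q = T* v`, then testing against `(v, q)` gives `‖q‖² + ‖v‖² = 0`. -/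
theorem adjoint_adjoint_of_isClosed {T : E →ₗ.[ℂ] F} (hc : T.IsClosed)
    (hd : Dense (T.domain : Set E)) : T†† = T := by
  refine eq_of_mem_graph_iff fun x y => ?_
  rw [mem_graph_adjoint (dense_domain_adjoint hc hd)]
  constructor
  · intro h
    obtain ⟨u, p, v, q, h1, h2, rfl, rfl⟩ := exists_graph_decomposition hc hd x y
    have h3 := h _ _ h2
    have h4 := (mem_graph_adjoint hd).1 h2 _ _ h1
    have h5 : inner ℂ v p = inner ℂ q u := by
      rw [← inner_conj_symm, h4, inner_conj_symm]
    rw [inner_sub_right, inner_add_right, h5] at h3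
    have h7 : ‖q‖ ^ 2 + ‖v‖ ^ 2 = 0 := by
      have := congrArg RCLike.re (show inner ℂ q q + inner ℂ v v = 0 by linear_combination -h3)
      rwa [map_add, inner_self_eq_norm_sq, inner_self_eq_norm_sq, map_zero] at this
    have hv : v = 0 := norm_eq_zero.1 (by nlinarith [sq_nonneg ‖q‖, sq_nonneg ‖v‖])
    have hq : q = 0 := norm_eq_zero.1 (by nlinarith [sq_nonneg ‖q‖, sq_nonneg ‖v‖])
    subst hv hq
    simpa using h1
  · intro h w z hwz
    rw [← inner_conj_symm, ← (mem_graph_adjoint hd).1 hwz _ _ h, inner_conj_symm]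

/-- A bounded injective operator `C` with dense range has a polar decomposition `C = W |C|` with `W`
unitary. -/
theorem exists_polar_decomposition (C : E →L[ℂ] F) (hinj : ∀ x, C x = 0 → x = 0)
    (hdense : DenseRange C) :
    ∃ (W : E ≃ₗᵢ[ℂ] F) (B : E →L[ℂ] E), (∀ x, W (B x) = C x) ∧ DenseRange B ∧
      ∀ R : E →L[ℂ] E, Commute (C.adjoint ∘L C) R → Commute B R := by
  let D : E →L[ℂ] E := C.adjoint ∘L C
  have hD : 0 ≤ D := (ContinuousLinearMap.nonneg_iff_isPositive _).2
    (ContinuousLinearMap.isPositive_adjoint_comp_self C)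
  let B := CFC.sqrt D
  have hBB : B ∘L B = D := CFC.sqrt_mul_sqrt_self D hD
  have hBsa : B.adjoint = B := (IsSelfAdjoint.of_nonneg (CFC.sqrt_nonneg D)).star_eq
  have hnorm : ∀ x, ‖C x‖ = ‖B x‖ := by
    intro x
    have h1 : inner ℂ (C x) (C x) = inner ℂ (B x) (B x) := by
      rw [← ContinuousLinearMap.adjoint_inner_right, ← ContinuousLinearMap.adjoint_inner_right, hBsa]
      exact congrArg (fun S : E →L[ℂ] E => inner ℂ x (S x)) hBB.symm
    rw [← sq_eq_sq₀ (norm_nonneg _) (norm_nonneg _), ← inner_self_eq_norm_sq (𝕜 := ℂ),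
      ← inner_self_eq_norm_sq (𝕜 := ℂ), h1]
  have hBdense : DenseRange B := by
    change Dense (LinearMap.range (B : E →ₗ[ℂ] E) : Set E)
    rw [Submodule.dense_iff_topologicalClosure_eq_top, Submodule.topologicalClosure_eq_top_iff,
      Submodule.eq_bot_iff]
    intro y hy
    refine hinj y (norm_eq_zero.1 ?_)
    rw [hnorm, norm_eq_zero]
    refine ext_inner_left ℂ fun v => ?_
    rw [inner_zero_right, ← ContinuousLinearMap.adjoint_inner_left, hBsa]
    exact hy _ ⟨v, rfl⟩
  -- `W` extends the isometry `B x ↦ C x` between dense ranges; the square root `B` commutes with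
  -- whatever commutes with `C* C`, by the functional calculus.
  refine ⟨(LinearEquiv.refl ℂ E).extendOfIsometry (B : E →ₗ[ℂ] E) (C : E →ₗ[ℂ] F) hBdense hdense
    hnorm, B, fun x => ?_, hBdense, fun R hR => hR.cfcₙ_nnreal _⟩
  exact LinearEquiv.extendOfIsometry_eq _ _ _ hBdense hdense hnorm x

end Adjoint

/-! ### Unitary equivalence of `T* T` and `T T*` -/

section Factorization

variable {E F : Type*} [NormedAddCommGroup E] [InnerProductSpace ℂ E] [CompleteSpace E]
  [NormedAddCommGroup F] [InnerProductSpace ℂ F] [CompleteSpace F]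

/-- For `T` closed, densely defined, injective and with dense range, `T` maps the domain of `T* T`
onto a dense subspace, and `T* T` and `T T*` are unitarily equivalent. -/
theorem dense_and_exists_unitary_intertwining {T : E →ₗ.[ℂ] F} (hc : T.IsClosed)
    (hd : Dense (T.domain : Set E)) (hr : Dense (ran T : Set F))
    (hk : LinearMap.ker T.toFun = ⊥) :
    Dense {y | ∃ x z, (x, y) ∈ T.graph ∧ (y, z) ∈ T†.graph} ∧
    ∃ W : E ≃ₗᵢ[ℂ] F, ∀ u w,
      (u, w) ∈ (prod (T†) T).graph ↔ (W u, W w) ∈ (prod T (T†)).graph := by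
  obtain ⟨R, C, C', Q, h⟩ := exists_graph_projection hc hd
  have h1 : ∀ a, (R a, C a) ∈ T.graph ∧ (-C a, R a - a) ∈ T†.graph := fun a => by
    simpa using (h a 0 (R a) (C a)).1 (by simp)
  have h2 : ∀ b, (C' b, Q b) ∈ T.graph ∧ (b - Q b, C' b) ∈ T†.graph := fun b => by
    simpa using (h 0 b (C' b) (Q b)).1 (by simp)
  -- Self-adjointness of the projection, read off from the two adjoint relations.
  have hadj : C.adjoint = C' := by
    refine ContinuousLinearMap.ext fun y => ext_inner_left ℂ fun x => ?_
    rw [ContinuousLinearMap.adjoint_inner_right]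
    have e1 := (mem_graph_adjoint hd).1 (h2 y).2 _ _ (h1 x).1
    have e2 := (mem_graph_adjoint hd).1 (h1 x).2 _ _ (h2 y).1
    have e3 : inner ℂ (C x) (Q y) = - inner ℂ (R x - x) (C' y) := by
      rw [← inner_conj_symm, ← inner_conj_symm (R x - x), ← e2, inner_neg_right, map_neg, neg_neg]
    rw [inner_sub_right, e3, inner_sub_left] at e1
    linear_combination e1
  have hCinj : ∀ x, C x = 0 → x = 0 := by
    intro x hx
    have e1 := h1 x
    rw [hx, neg_zero] at e1
    have e2 := ker_eq_bot_iff_graph.1 hk _ e1.1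
    have e3 := (T†).graph_fst_eq_zero_snd e1.2 rfl
    rwa [e2, zero_sub, neg_eq_zero] at e3
  have hC'inj : ∀ y, C' y = 0 → y = 0 := by
    intro y hy
    have e1 := h2 y
    rw [hy] at e1
    have e2 := T.graph_fst_eq_zero_snd e1.1 rfl
    have e3 := ker_eq_bot_iff_graph.1 (ker_adjoint_eq_bot hd hr) _ e1.2
    rwa [e2, sub_zero] at e3
  have hCdense : DenseRange C := by
    change Dense (LinearMap.range (C : E →ₗ[ℂ] F) : Set F)
    rw [Submodule.dense_iff_topologicalClosure_eq_top, Submodule.topologicalClosure_eq_top_iff,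
      Submodule.eq_bot_iff]
    intro y hy
    refine hC'inj y (ext_inner_left ℂ fun v => ?_)
    rw [inner_zero_right, ← hadj, ContinuousLinearMap.adjoint_inner_right]
    exact hy _ ⟨v, rfl⟩
  refine ⟨hCdense.mono ?_, ?_⟩
  · rintro _ ⟨x, rfl⟩
    refine ⟨R x, x - R x, (h1 x).1, ?_⟩
    simpa using (T†).graph.neg_mem (h1 x).2
  -- The projection fixes `(R x, C x)`, which already lies in the graph.
  have hidem : ∀ x, R (R x) + C' (C x) = R x ∧ C (R x) + Q (C x) = C x := fun x =>
    (h _ _ _ _).2 ⟨(h1 x).1, by simp⟩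
  obtain ⟨W, B, hWB, hBdense, hBcomm⟩ := exists_polar_decomposition C hCinj hCdense
  -- Idempotence gives `C* C = R - R²`, which commutes with `R`.
  have hBR : ∀ x, B (R x) = R (B x) := by
    have : Commute (C.adjoint ∘L C) R := by
      refine ContinuousLinearMap.ext fun x => ?_
      change C.adjoint (C (R x)) = R (C.adjoint (C x))
      rw [hadj, eq_sub_of_add_eq' (hidem (R x)).1, eq_sub_of_add_eq' (hidem x).1, map_sub]
    exact fun x => congrArg (fun S : E →L[ℂ] E => S x) (hBcomm R this)
  -- On the dense range of `B`: `W R B = W B R = C R = (1 - Q) C = (1 - Q) W B`.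
  have hWR : ∀ x, W (R x) = W x - Q (W x) := by
    intro x
    refine hBdense.induction_on (p := fun x => W (R x) = W x - Q (W x)) x
      (isClosed_eq (by fun_prop) (by fun_prop)) fun x => ?_
    rw [← hBR, hWB, hWB, eq_sub_iff_add_eq]
    exact (hidem x).2
  refine ⟨W, fun u w => ?_⟩
  -- Here and in `e2` both graphs are expressed through bounded operators, so that `hWR` can compare
  -- them.
  have e1 : (u, w) ∈ (prod (T†) T).graph ↔ R (w + u) = u := by
    rw [mem_graph_prod]
    constructor
    · rintro ⟨y, hy1, hy2⟩
      simpa using ((h (w + u) 0 u y).2 ⟨hy1, by simpa using (T†).graph.neg_mem hy2⟩).1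
    · intro e
      have := h1 (w + u)
      rw [e] at this
      exact ⟨_, this.1, by simpa using (T†).graph.neg_mem this.2⟩
  have e2 : (W u, W w) ∈ (prod T (T†)).graph ↔ Q (W u + W w) = W w := by
    rw [mem_graph_prod]
    constructor
    · rintro ⟨x, hx1, hx2⟩
      simpa using ((h 0 (W u + W w) x (W w)).2 ⟨hx2, by simpa using hx1⟩).2
    · intro e
      have := h2 (W u + W w)
      rw [e] at this
      exact ⟨_, by simpa using this.2, this.1⟩
  rw [e1, e2, ← W.injective.eq_iff, hWR, map_add, add_comm (W w), sub_eq_iff_eq_add,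
    add_right_inj, eq_comm]

end Factorization

/-! ### The completions as unitary images, and extension by density -/

section Completion

variable {V E F : Type*} [AddCommGroup V] [Module ℂ V]
  [NormedAddCommGroup E] [InnerProductSpace ℂ E]
  [NormedAddCommGroup F] [InnerProductSpace ℂ F]

theorem denseRange_toCompletion (f : V →ₗ[ℂ] E) : DenseRange (toCompletion f) :=
  UniformSpace.Completion.denseRange_coe (α := Pullback f)

theorem norm_toCompletion (f : V →ₗ[ℂ] E) (x : V) : ‖toCompletion f x‖ = ‖f x‖ := by
  rw [← sq_eq_sq₀ (norm_nonneg _) (norm_nonneg _), ← inner_self_eq_norm_sq (𝕜 := ℂ),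
    ← inner_self_eq_norm_sq (𝕜 := ℂ), inner_toCompletion]

/-- For the pulled-back norm `f` is isometric, so `E`, being complete, is itself a completion. -/
theorem exists_unitary_completion [CompleteSpace E] (f : V →ₗ[ℂ] E) (hf : DenseRange f) :
    ∃ W : E ≃ₗᵢ[ℂ] UniformSpace.Completion (Pullback f), ∀ x, W (f x) = toCompletion f x :=
  ⟨(LinearEquiv.refl ℂ V).extendOfIsometry f (toCompletion f) hf (denseRange_toCompletion f)
    (norm_toCompletion f), fun x => LinearEquiv.extendOfIsometry_eq _ _ _ hf
      (denseRange_toCompletion f) (norm_toCompletion f) x⟩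

theorem null_eq_bot {T : E →ₗ.[ℂ] F} (hk : LinearMap.ker T.toFun = ⊥) : null T = ⊥ := by
  rw [null, hk, Submodule.map_bot]

/-- If `T` is injective with dense range, then `𝓓(T)` is a unitary image of the target space, and
`i_T` becomes `T⁻¹`. -/
theorem exists_unitary_iEmb [CompleteSpace F] {T : E →ₗ.[ℂ] F} (hr : Dense (ran T : Set F))
    (hk : LinearMap.ker T.toFun = ⊥) :
    ∃ V : F ≃ₗᵢ[ℂ] DSpace T, ∀ z y, (z, y) ∈ (iEmb T).graph ↔ (y, V.symm z) ∈ T.graph := by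
  -- With trivial null space, nothing is removed from the domain.
  have hmem : ∀ x : T.domain, (x : E) ∈ domMinusKer T := fun x =>
    ⟨x.2, by rw [null_eq_bot hk, Submodule.bot_orthogonal_eq_top]; trivial⟩
  obtain ⟨V, hV⟩ := exists_unitary_completion (dMap T) <| hr.mono <| by
    rintro _ ⟨x, rfl⟩
    exact ⟨⟨x, hmem x⟩, rfl⟩
  refine ⟨V, fun z y => ?_⟩
  rw [mem_graph_iEmb]
  constructor
  · rintro ⟨x, rfl, rfl⟩
    rw [← hV, V.symm_apply_apply]
    exact T.mem_graph ⟨x, x.2.1⟩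
  · intro h
    obtain ⟨x, rfl, h2⟩ := (LinearPMap.mem_graph_iff _).1 h
    refine ⟨⟨x, hmem x⟩, ?_, rfl⟩
    rw [← hV, ← V.apply_symm_apply z]
    exact congrArg V h2

/-- If `S` is injective and densely defined, then `𝓡(S)` is a unitary image of the source space, and
`j_S` becomes `S`. -/
theorem exists_unitary_jEmb [CompleteSpace E] {S : E →ₗ.[ℂ] F} (hd : Dense (S.domain : Set E))
    (hk : LinearMap.ker S.toFun = ⊥) :
    ∃ U : E ≃ₗᵢ[ℂ] RSpace S, ∀ z y, (z, y) ∈ (jEmb S).graph ↔ (U.symm z, y) ∈ S.graph := by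
  have happ : ∀ (x : S.domain) (h : S x ∈ ran S), rMap S ⟨S x, h⟩ = x := fun x h =>
    rMap_apply_of_mem S x (by rw [null_eq_bot hk, Submodule.bot_orthogonal_eq_top]; trivial) h
  obtain ⟨U, hU⟩ := exists_unitary_completion (rMap S) <| hd.mono <| by
    intro x hx
    exact ⟨⟨S ⟨x, hx⟩, ⟨x, hx⟩, rfl⟩, happ _ _⟩
  refine ⟨U, fun z y => ?_⟩
  rw [mem_graph_jEmb S (by rw [null_eq_bot hk]; exact isClosed_singleton)]
  constructor
  · rintro ⟨⟨_, x, rfl⟩, rfl, rfl⟩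
    rw [← hU, U.symm_apply_apply]
    exact (happ x ⟨x, rfl⟩).symm ▸ S.mem_graph x
  · intro h
    obtain ⟨x, h1, rfl⟩ := (LinearPMap.mem_graph_iff _).1 h
    refine ⟨⟨S x, x, rfl⟩, ?_, rfl⟩
    rw [← hU, ← U.apply_symm_apply z]
    exact congrArg U ((happ x ⟨x, rfl⟩).trans h1)

theorem isUniqueUnitaryExtension_of_dense {S : E →ₗ.[ℂ] F} {W : E ≃ₗᵢ[ℂ] F}
    (hd : Dense (S.domain : Set E)) (h : ∀ x y, (x, y) ∈ S.graph → W x = y) :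
    IsUniqueUnitaryExtension S W := by
  refine ⟨le_of_mem_graph_imp fun x y hxy => mem_graph_ofUnitary.2 (h x y hxy), fun W' hW' => ?_⟩
  refine LinearIsometryEquiv.ext fun x => congrFun (Continuous.ext_on hd W'.continuous W.continuous
    fun x hx => ?_) x
  obtain ⟨y, hy⟩ := mem_domain_iff_exists.1 hx
  rw [h x y hy]
  exact mem_graph_ofUnitary.1 (LinearPMap.le_graph_of_le hW' hy)

theorem dense_preimage_unitary (W : E ≃ₗᵢ[ℂ] F) {s : Set F} (hs : Dense s) : Dense {x | W x ∈ s} :=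
  hs.preimage W.toHomeomorph.isOpenMap

/-- The Riesz isomorphism of a Hilbert space with its conjugate dual. -/
theorem exists_conjDual_isometry [CompleteSpace F] (A : E ≃ₗᵢ[ℂ] F) :
    ∃ Θ : E ≃ₗᵢ[ℂ] (F →L⋆[ℂ] ℂ), ∀ (a : E) (x : F), Θ a x = inner ℂ x (A a) := by
  let f : F →ₗᵢ[ℂ] (F →L⋆[ℂ] ℂ) :=
    { toLinearMap := ((innerSL ℂ (E := F)).flip : F →ₗ[ℂ] (F →L⋆[ℂ] ℂ))
      norm_map' := fun y => by
        refine le_antisymm (ContinuousLinearMap.opNorm_le_bound _ (norm_nonneg y) fun x => ?_) ?_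
        · rw [mul_comm]
          exact norm_inner_le_norm x y
        · rcases eq_or_ne y 0 with rfl | hy
          · simp
          · have h := ContinuousLinearMap.le_opNorm ((innerSL ℂ (E := F)).flip y) y
            have h2 : ‖(innerSL ℂ (E := F)).flip y y‖ = ‖y‖ * ‖y‖ := by
              change ‖inner ℂ y y‖ = ‖y‖ * ‖y‖
              rw [inner_self_eq_norm_sq_to_K, norm_pow, RCLike.norm_ofReal, abs_norm, sq]
            rw [h2] at h
            exact le_of_mul_le_mul_right h (norm_pos_iff.2 hy) }
  have hf : Function.Surjective f := by
    intro φ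
    -- Conjugating `φ` makes it linear, so that the usual Riesz theorem applies.
    let ψ : StrongDual ℂ F :=
      ((starL ℂ : ℂ ≃L⋆[ℂ] ℂ) : ℂ →L⋆[ℂ] ℂ).comp φ
    refine ⟨(InnerProductSpace.toDual ℂ F).symm ψ, ContinuousLinearMap.ext fun x => ?_⟩
    change inner ℂ x ((InnerProductSpace.toDual ℂ F).symm ψ) = φ x
    rw [← inner_conj_symm, InnerProductSpace.toDual_symm_apply]
    exact star_star (φ x)
  exact ⟨A.trans (LinearIsometryEquiv.ofSurjective f hf), fun a x => rfl⟩

end Completion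

/-! ### The variational formula for the norm -/

section Supremum

variable {E F : Type*} [NormedAddCommGroup E] [InnerProductSpace ℂ E] [CompleteSpace E]
  [NormedAddCommGroup F] [InnerProductSpace ℂ F]

/-- For `T` injective with dense range, the norm of `g ∈ Dom(T*)` is a supremum of quotients
involving `T* g` only. -/
theorem norm_eq_sSup_quotient {T : E →ₗ.[ℂ] F} (hd : Dense (T.domain : Set E))
    (hr : Dense (ran T : Set F)) (hk : LinearMap.ker T.toFun = ⊥) {g : F} {w : E}
    (h : (g, w) ∈ T†.graph) :
    BddAbove {r : ℝ | ∃ x : T.domain, x ≠ 0 ∧ r = ‖inner ℂ (x : E) w‖ / ‖T x‖} ∧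
      ‖g‖ = sSup {r : ℝ | ∃ x : T.domain, x ≠ 0 ∧ r = ‖inner ℂ (x : E) w‖ / ‖T x‖} := by
  set s := {r : ℝ | ∃ x : T.domain, x ≠ 0 ∧ r = ‖inner ℂ (x : E) w‖ / ‖T x‖}
  have hin : ∀ x : T.domain, inner ℂ (x : E) w = inner ℂ (T x) g := fun x =>
    ((mem_graph_adjoint hd).1 h x (T x) (T.mem_graph x)).symm
  have hle : ∀ r ∈ s, r ≤ ‖g‖ := by
    rintro _ ⟨x, -, rfl⟩
    rw [hin]
    exact div_le_of_le_mul₀ (norm_nonneg _) (norm_nonneg _)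
      ((norm_inner_le_norm _ _).trans_eq (mul_comm _ _))
  have hb : BddAbove s := ⟨‖g‖, hle⟩
  -- This includes the empty set, whose supremum is `0` by convention.
  have h0 : 0 ≤ sSup s := Real.sSup_nonneg <| by
    rintro _ ⟨x, -, rfl⟩
    positivity
  refine ⟨hb, le_antisymm ?_ (Real.sSup_le hle (norm_nonneg _))⟩
  -- The bound holds on `Ran(T)` and passes to its closure; taking `u = g` then gives the
  -- inequality.
  have hall : ∀ u : F, ‖inner ℂ u g‖ ≤ sSup s * ‖u‖ := by
    intro u
    refine hr.induction (P := fun u => ‖inner ℂ u g‖ ≤ sSup s * ‖u‖) ?_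
      (isClosed_le (by fun_prop) (by fun_prop)) u
    rintro _ ⟨x, rfl⟩
    change ‖inner ℂ (T x) g‖ ≤ sSup s * ‖T x‖
    by_cases hx : x = 0
    · simp [hx]
    · have hT : T x ≠ 0 := fun e => hx (LinearMap.ker_eq_bot'.1 hk x e)
      rw [← div_le_iff₀ (norm_pos_iff.2 hT), ← hin]
      exact le_csSup hb ⟨x, hx, rfl⟩
  rcases eq_or_ne g 0 with rfl | hg
  · simpa using h0
  · have := hall g
    rw [inner_self_eq_norm_sq_to_K, norm_pow, RCLike.norm_ofReal, abs_norm, sq] at this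
    exact le_of_mul_le_mul_right this (norm_pos_iff.2 hg)

end Supremum

/-! ### Operators that are `T⁻¹` and `T*` up to unitary operators -/

/-- `T` is closed, densely defined, injective with dense range, and `i = T⁻¹ V⁻¹`, `j = T* U⁻¹`. -/
structure Factorizes {E F D S : Type*} [NormedAddCommGroup E] [InnerProductSpace ℂ E]
    [CompleteSpace E] [NormedAddCommGroup F] [InnerProductSpace ℂ F]
    [NormedAddCommGroup D] [InnerProductSpace ℂ D] [NormedAddCommGroup S] [InnerProductSpace ℂ S]
    (T : E →ₗ.[ℂ] F) (i : D →ₗ.[ℂ] E) (j : S →ₗ.[ℂ] E) (V : F ≃ₗᵢ[ℂ] D) (U : F ≃ₗᵢ[ℂ] S) :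
    Prop where
  closed : T.IsClosed
  dense : Dense (T.domain : Set E)
  dense_ran : Dense (ran T : Set F)
  ker : LinearMap.ker T.toFun = ⊥
  graph_i : ∀ {z y}, (z, y) ∈ i.graph ↔ (y, V.symm z) ∈ T.graph
  graph_j : ∀ {z y}, (z, y) ∈ j.graph ↔ (U.symm z, y) ∈ T†.graph

namespace Factorizes

set_option linter.unusedSectionVars false

variable {E F D S : Type*} [NormedAddCommGroup E] [InnerProductSpace ℂ E]
    [CompleteSpace E] [NormedAddCommGroup F] [InnerProductSpace ℂ F] [CompleteSpace F]
    [NormedAddCommGroup D] [InnerProductSpace ℂ D] [CompleteSpace D]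
    [NormedAddCommGroup S] [InnerProductSpace ℂ S] [CompleteSpace S]
    {T : E →ₗ.[ℂ] F} {i : D →ₗ.[ℂ] E} {j : S →ₗ.[ℂ] E} {V : F ≃ₗᵢ[ℂ] D} {U : F ≃ₗᵢ[ℂ] S}
    (h : Factorizes T i j V U)

include h

/-! ### The embedding `i` and its kernel operator -/

theorem ker_adjoint : LinearMap.ker (T†).toFun = ⊥ := ker_adjoint_eq_bot h.dense h.dense_ran

theorem ker_i : LinearMap.ker i.toFun = ⊥ := by
  refine ker_eq_bot_iff_graph.2 fun z hz => ?_
  simpa using T.graph_fst_eq_zero_snd (h.graph_i.1 hz) rfl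

theorem ker_j : LinearMap.ker j.toFun = ⊥ := by
  refine ker_eq_bot_iff_graph.2 fun z hz => ?_
  simpa using ker_eq_bot_iff_graph.1 h.ker_adjoint _ (h.graph_j.1 hz)

theorem dense_domain_i : Dense (i.domain : Set D) := by
  refine (dense_preimage_unitary V.symm h.dense_ran).mono fun z hz => ?_
  obtain ⟨x, hx⟩ := mem_ran_iff_exists.1 hz
  exact mem_domain_iff_exists.2 ⟨x, h.graph_i.2 hx⟩

theorem ran_i : ran i = T.domain := by
  ext x
  rw [mem_ran_iff_exists, mem_domain_iff_exists]
  constructor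
  · rintro ⟨z, hz⟩
    exact ⟨_, h.graph_i.1 hz⟩
  · rintro ⟨y, hy⟩
    exact ⟨V y, h.graph_i.2 (by rwa [V.symm_apply_apply])⟩

theorem mem_graph_adjoint_i {x z} : (x, z) ∈ i†.graph ↔ (V.symm z, x) ∈ T†.graph := by
  rw [mem_graph_adjoint h.dense_domain_i, mem_graph_adjoint h.dense]
  constructor
  · intro H x' p hp
    have := H (V p) x' (h.graph_i.2 (by rwa [V.symm_apply_apply]))
    rw [this, ← V.symm.inner_map_map, V.symm_apply_apply]
  · intro H z' x' hz'
    rw [← H _ _ (h.graph_i.1 hz'), V.symm.inner_map_map]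

theorem mem_graph_kernelOperator_i {x u} :
    (x, u) ∈ (kernelOperator i).graph ↔ (u, x) ∈ (prod (T†) T).graph := by
  rw [kernelOperator, mem_graph_prod, mem_graph_prod]
  constructor
  · rintro ⟨z, h1, h2⟩
    exact ⟨V.symm z, h.graph_i.1 h2, h.mem_graph_adjoint_i.1 h1⟩
  · rintro ⟨y, h1, h2⟩
    exact ⟨V y, h.mem_graph_adjoint_i.2 (by rwa [V.symm_apply_apply]),
      h.graph_i.2 (by rwa [V.symm_apply_apply])⟩

theorem isCloseEmbedding_i : IsCloseEmbedding i where
  dense_domain := h.dense_domain_i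
  injective := LinearMap.ker_eq_bot.1 h.ker_i
  isClosed := by
    have : (i.graph : Set (D × E)) = (fun p => (p.2, V.symm p.1)) ⁻¹' (T.graph : Set (E × F)) :=
      Set.ext fun p => h.graph_i
    rw [LinearPMap.IsClosed, this]
    exact h.closed.preimage (by fun_prop)

theorem kernelOperator_i_eq (hk : LinearMap.ker (prod (T†) T).toFun = ⊥) :
    kernelOperator i = (prod (T†) T).inverse :=
  eq_of_mem_graph_iff fun x u => by rw [h.mem_graph_kernelOperator_i, mem_graph_inverse hk]

/-! ### The embedding `j⁻¹` and its kernel operator -/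

theorem mem_graph_inverse_j {y z} : (y, z) ∈ j.inverse.graph ↔ (U.symm z, y) ∈ T†.graph := by
  rw [mem_graph_inverse h.ker_j, h.graph_j]

theorem domain_inverse_j : j.inverse.domain = ran (T†) := by
  ext x
  rw [mem_ran_iff_exists, mem_domain_iff_exists]
  constructor
  · rintro ⟨z, hz⟩
    exact ⟨_, h.mem_graph_inverse_j.1 hz⟩
  · rintro ⟨y, hy⟩
    exact ⟨U y, h.mem_graph_inverse_j.2 (by rwa [U.symm_apply_apply])⟩

theorem adjoint_adjoint : T†† = T := adjoint_adjoint_of_isClosed h.closed h.dense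

theorem dense_domain_adjoint : Dense (T†.domain : Set F) :=
  CloseEmb.dense_domain_adjoint h.closed h.dense

/-- A vector orthogonal to `Ran(T*)` lies in the null space of `T** = T`, which is trivial. -/
theorem dense_domain_inverse_j : Dense (j.inverse.domain : Set E) := by
  rw [h.domain_inverse_j, Submodule.dense_iff_topologicalClosure_eq_top,
    Submodule.topologicalClosure_eq_top_iff, Submodule.eq_bot_iff]
  intro x hx
  refine ker_eq_bot_iff_graph.1 h.ker x ?_
  rw [← h.adjoint_adjoint, mem_graph_adjoint h.dense_domain_adjoint]
  intro y z hyz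
  rw [inner_zero_right]
  exact hx z (mem_ran_iff_exists.2 ⟨y, hyz⟩)

theorem mem_graph_adjoint_inverse_j {w y} :
    (w, y) ∈ (j.inverse)†.graph ↔ (y, U.symm w) ∈ T.graph := by
  rw [mem_graph_adjoint h.dense_domain_inverse_j]
  conv_rhs => rw [← h.adjoint_adjoint, mem_graph_adjoint h.dense_domain_adjoint]
  constructor
  · intro H v y' hv
    rw [← H y' (U v) (h.mem_graph_inverse_j.2 (by rwa [U.symm_apply_apply])),
      ← U.symm.inner_map_map, U.symm_apply_apply]
  · intro H y' z hz
    rw [H _ _ (h.mem_graph_inverse_j.1 hz), U.symm.inner_map_map]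

theorem mem_graph_kernelOperator_inverse_j {w z} :
    (w, z) ∈ (kernelOperator j.inverse).graph ↔
      (U.symm z, U.symm w) ∈ (prod T (T†)).graph := by
  rw [kernelOperator, mem_graph_prod, mem_graph_prod]
  simp only [h.mem_graph_adjoint_inverse_j, h.mem_graph_inverse_j, and_comm]

theorem isCloseEmbedding_inverse_j : IsCloseEmbedding j.inverse where
  dense_domain := h.dense_domain_inverse_j
  injective := by
    refine LinearMap.ker_eq_bot.1 (ker_eq_bot_iff_graph.2 fun y hy => ?_)
    exact (T†).graph_fst_eq_zero_snd (h.mem_graph_inverse_j.1 hy) (map_zero U.symm)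
  isClosed := by
    have : (j.inverse.graph : Set (E × S)) =
        (fun p => (U.symm p.2, p.1)) ⁻¹' (T†.graph : Set (F × E)) :=
      Set.ext fun p => h.mem_graph_inverse_j
    rw [LinearPMap.IsClosed, this]
    exact (LinearPMap.adjoint_isClosed h.dense).preimage (by fun_prop)

theorem dense_domain_j : Dense (j.domain : Set S) := by
  refine (dense_preimage_unitary U.symm h.dense_domain_adjoint).mono fun z hz => ?_
  obtain ⟨x, hx⟩ := mem_domain_iff_exists.1 hz
  exact mem_domain_iff_exists.2 ⟨x, h.graph_j.2 hx⟩

theorem dense_ran_inverse_j : Dense (ran j.inverse : Set S) := by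
  refine h.dense_domain_j.mono fun z hz => ?_
  obtain ⟨x, hx⟩ := mem_domain_iff_exists.1 hz
  exact mem_ran_iff_exists.2 ⟨x, (mem_graph_inverse h.ker_j).2 hx⟩

theorem unitarilyEquivalent_kernelOperator :
    UnitarilyEquivalent (kernelOperator j.inverse) (kernelOperator i) := by
  obtain ⟨-, W, hW⟩ :=
    dense_and_exists_unitary_intertwining h.closed h.dense h.dense_ran h.ker
  -- `U⁻¹` carries the kernel operator to `(T T*)⁻¹`, and `W⁻¹` carries this to `(T* T)⁻¹`.
  refine ⟨U.symm.trans W.symm, eq_of_mem_graph_iff fun x u => ?_⟩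
  rw [h.mem_graph_kernelOperator_i, hW]
  simp only [mem_graph_prod, mem_graph_ofUnitary, h.mem_graph_kernelOperator_inverse_j]
  constructor
  · intro H
    exact ⟨U (W u), ⟨U (W x), by simp, by simpa using H⟩, by simp⟩
  · rintro ⟨_, ⟨_, rfl, h2⟩, rfl⟩
    simpa using h2

/-! ### The unitary extensions -/

theorem ran_adjoint_le_domain_adjoint_i : ran (T†) ≤ i†.domain := by
  intro x hx
  obtain ⟨y, hy⟩ := mem_ran_iff_exists.1 hx
  exact mem_domain_iff_exists.2 ⟨V y, h.mem_graph_adjoint_i.2 (by rwa [V.symm_apply_apply])⟩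

theorem extension_adjoint_i :
    IsUniqueUnitaryExtension (prod (i†) j) (U.symm.trans V) := by
  refine isUniqueUnitaryExtension_of_dense (h.dense_domain_j.mono fun s hs => ?_) fun s d hsd => ?_
  · obtain ⟨y, hy⟩ := mem_domain_iff_exists.1 hs
    refine mem_domain_iff_exists.2 ⟨V (U.symm s), mem_graph_prod.2 ⟨y, hy, ?_⟩⟩
    rw [h.mem_graph_adjoint_i, V.symm_apply_apply]
    exact h.graph_j.1 hy
  · obtain ⟨y, h1, h2⟩ := mem_graph_prod.1 hsd
    rw [LinearIsometryEquiv.trans_apply,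
      graph_injective h.ker_adjoint (h.graph_j.1 h1) (h.mem_graph_adjoint_i.1 h2),
      V.apply_symm_apply]

theorem domain_kernelOperator_i_le : (kernelOperator i).domain ≤ ran (T†) := by
  intro x hx
  obtain ⟨u, hu⟩ := mem_domain_iff_exists.1 hx
  obtain ⟨y, -, h2⟩ := mem_graph_prod.1 (h.mem_graph_kernelOperator_i.1 hu)
  exact mem_ran_iff_exists.2 ⟨y, h2⟩

theorem ran_kernelOperator_i_le : ran (kernelOperator i) ≤ T.domain := by
  intro x hx
  obtain ⟨u, hu⟩ := mem_ran_iff_exists.1 hx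
  obtain ⟨y, h2, -⟩ := mem_graph_prod.1 (h.mem_graph_kernelOperator_i.1 hu)
  exact mem_domain_iff_exists.2 ⟨y, h2⟩

theorem dense_core : Dense {y | ∃ x z, (x, y) ∈ T.graph ∧ (y, z) ∈ T†.graph} :=
  (dense_and_exists_unitary_intertwining h.closed h.dense h.dense_ran h.ker).1

/-- The kernel operator sends `T* T x` to `x`; in `𝓖`-coordinates both vectors are represented by `T
x`. The domain is dense by `dense_core`. -/
theorem extension_kernelOperator_i :
    IsUniqueUnitaryExtension (prod i.inverse (prod (kernelOperator i) j)) (U.symm.trans V) := by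
  refine isUniqueUnitaryExtension_of_dense
    ((dense_preimage_unitary U.symm h.dense_core).mono ?_) fun s d hsd => ?_
  · rintro s ⟨x, z, h1, h2⟩
    refine mem_domain_iff_exists.2 ⟨V (U.symm s), mem_graph_prod.2 ⟨x, mem_graph_prod.2
      ⟨z, h.graph_j.2 h2, h.mem_graph_kernelOperator_i.2 (mem_graph_prod.2 ⟨_, h1, h2⟩)⟩, ?_⟩⟩
    rwa [mem_graph_inverse h.ker_i, h.graph_i, V.symm_apply_apply]
  · obtain ⟨y, h1, h2⟩ := mem_graph_prod.1 hsd
    obtain ⟨w, h3, h4⟩ := mem_graph_prod.1 h1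
    obtain ⟨p, h5, h6⟩ := mem_graph_prod.1 (h.mem_graph_kernelOperator_i.1 h4)
    rw [mem_graph_inverse h.ker_i, h.graph_i] at h2
    rw [LinearIsometryEquiv.trans_apply, graph_injective h.ker_adjoint (h.graph_j.1 h3) h6,
      T.mem_graph_snd_inj h5 h2 rfl, V.apply_symm_apply]

/-- `T* T`, viewed as an operator between the spaces `D` and `S`, acts as `U V⁻¹`. -/
theorem mem_graph_prod_inverse_j_i {d s} :
    (d, s) ∈ (prod j.inverse (prod (prod (T†) T) i)).graph ↔
      U (V.symm d) = s ∧
        V.symm d ∈ {y | ∃ x z, (x, y) ∈ T.graph ∧ (y, z) ∈ T†.graph} := by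
  simp only [mem_graph_prod, h.graph_i, h.mem_graph_inverse_j]
  constructor
  · rintro ⟨w, ⟨x, h1, y, h2, h3⟩, h4⟩
    obtain rfl := T.mem_graph_snd_inj h2 h1 rfl
    exact ⟨by rw [graph_injective h.ker_adjoint h3 h4, U.apply_symm_apply], x, w, h1, h3⟩
  · rintro ⟨rfl, x, w, h1, h2⟩
    exact ⟨w, ⟨x, h1, _, h1, h2⟩, by rwa [U.symm_apply_apply]⟩

theorem dense_domain_prod_inverse_j_i :
    Dense ((prod j.inverse (prod (prod (T†) T) i)).domain : Set D) :=
  (dense_preimage_unitary V.symm h.dense_core).mono fun _ hd =>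
    mem_domain_iff_exists.2 ⟨_, h.mem_graph_prod_inverse_j_i.2 ⟨rfl, hd⟩⟩

theorem dense_ran_prod_inverse_j_i :
    Dense (ran (prod j.inverse (prod (prod (T†) T) i)) : Set S) :=
  (dense_preimage_unitary U.symm h.dense_core).mono fun s hs =>
    mem_ran_iff_exists.2 ⟨V (U.symm s), h.mem_graph_prod_inverse_j_i.2
      ⟨by simp, by rwa [V.symm_apply_apply]⟩⟩

theorem extension_prod_inverse_j_i :
    IsUniqueUnitaryExtension (prod j.inverse (prod (prod (T†) T) i)) (V.symm.trans U) :=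
  isUniqueUnitaryExtension_of_dense h.dense_domain_prod_inverse_j_i
    fun _ _ hds => (h.mem_graph_prod_inverse_j_i.1 hds).1

theorem norm_prod_inverse_j_i (x : (prod j.inverse (prod (prod (T†) T) i)).domain) :
    ‖prod j.inverse (prod (prod (T†) T) i) x‖ = ‖(x : D)‖ := by
  rw [← (h.mem_graph_prod_inverse_j_i.1 (LinearPMap.mem_graph _ x)).1, U.norm_map, V.symm.norm_map]

/-! ### Uniqueness of the factorizations -/

theorem inverse_eq_prod_i_iff (V' : F ≃ₗᵢ[ℂ] D) :
    T.inverse = prod i (ofUnitary V') ↔ V' = V := by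
  constructor
  · intro H
    refine LinearIsometryEquiv.ext fun y => congrFun (Continuous.ext_on h.dense_ran V'.continuous
      V.continuous fun y hy => ?_) y
    obtain ⟨x, hx⟩ := mem_ran_iff_exists.1 hy
    have h1 := (mem_graph_inverse h.ker).2 hx
    rw [H] at h1
    obtain ⟨d, h2, h3⟩ := mem_graph_prod.1 h1
    obtain rfl := mem_graph_ofUnitary.1 h2
    rw [T.mem_graph_snd_inj hx (h.graph_i.1 h3) rfl, V.apply_symm_apply,
      ← T.mem_graph_snd_inj hx (h.graph_i.1 h3) rfl]
  · rintro rfl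
    refine eq_of_mem_graph_iff fun y x => ?_
    simp only [mem_graph_inverse h.ker, mem_graph_prod, mem_graph_ofUnitary, h.graph_i,
      exists_eq_left', V'.symm_apply_apply]

theorem adjoint_eq_prod_j_iff (U' : F ≃ₗᵢ[ℂ] S) :
    T† = prod j (ofUnitary U') ↔ U' = U := by
  constructor
  · intro H
    refine LinearIsometryEquiv.ext fun y => congrFun (Continuous.ext_on h.dense_domain_adjoint
      U'.continuous U.continuous fun y hy => ?_) y
    obtain ⟨x, hx⟩ := mem_domain_iff_exists.1 hy
    have h1 := hx
    rw [H] at h1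
    obtain ⟨d, h2, h3⟩ := mem_graph_prod.1 h1
    obtain rfl := mem_graph_ofUnitary.1 h2
    conv_rhs => rw [graph_injective h.ker_adjoint hx (h.graph_j.1 h3)]
    rw [U.apply_symm_apply]
  · rintro rfl
    refine eq_of_mem_graph_iff fun y x => ?_
    simp only [mem_graph_prod, mem_graph_ofUnitary, h.graph_j, exists_eq_left',
      U'.symm_apply_apply]

end Factorizes

end CloseEmb

end

/-! ### The theorem -/

open CloseEmb LinearPMap in
theorem theorem4p1 {𝓗 𝓖 : Type*}
    [NormedAddCommGroup 𝓗] [InnerProductSpace ℂ 𝓗] [CompleteSpace 𝓗]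
    [NormedAddCommGroup 𝓖] [InnerProductSpace ℂ 𝓖] [CompleteSpace 𝓖]
    -- `H` is a positive selfadjoint operator with trivial null space
    (H : 𝓗 →ₗ.[ℂ] 𝓗) (hH : IsSelfAdjoint H)
    (hHpos : ∀ x : H.domain, 0 ≤ RCLike.re (inner ℂ (x : 𝓗) (H x)))
    (hHker : LinearMap.ker H.toFun = ⊥)
    -- `T` is closed, densely defined, with dense range, and `H = T* T`
    (T : 𝓗 →ₗ.[ℂ] 𝓖) (hTclosed : T.IsClosed) (hTdense : Dense (T.domain : Set 𝓗))
    (hTran : Dense (ran T : Set 𝓖)) (hHT : H = prod (T†) T) :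
    -- `𝓓(T)` is closely embedded in `𝓗`, and the kernel operator is `A = i_T i_T* = H⁻¹`
    (IsCloseEmbedding (iEmb T) ∧ Dense (ran (iEmb T) : Set 𝓗) ∧
      kernelOperator (iEmb T) = H.inverse) ∧
    -- `𝓗` is closely embedded in `𝓡(T*)`, and the kernel operator is unitarily equivalent to `A`
    (IsCloseEmbedding (jEmb (T†)).inverse ∧
      Dense (ran (jEmb (T†)).inverse : Set (RSpace (T†))) ∧
      UnitarilyEquivalent (kernelOperator (jEmb (T†)).inverse) (kernelOperator (iEmb T))) ∧
    ∃ (A' : RSpace (T†) ≃ₗᵢ[ℂ] DSpace T) (H' : DSpace T ≃ₗᵢ[ℂ] RSpace (T†)),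
      -- `A'` is the extension of `i_T* | Ran(T*)`, and of `A = i_T i_T*`, both viewed as
      -- operators from `𝓡(T*)` to `𝓓(T)`
      (ran (T†) ≤ (iEmb T)†.domain ∧
        IsUniqueUnitaryExtension (prod ((iEmb T)†) (jEmb (T†))) A' ∧
        (kernelOperator (iEmb T)).domain ≤ ran (T†) ∧
        ran (kernelOperator (iEmb T)) ≤ T.domain ∧
        IsUniqueUnitaryExtension
          (prod (iEmb T).inverse (prod (kernelOperator (iEmb T)) (jEmb (T†)))) A') ∧
      -- `H` viewed as an operator from `𝓓(T)` to `𝓡(T*)`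
      (H.domain ≤ T.domain ∧ ran H ≤ ran (T†) ∧
        Dense ((prod (jEmb (T†)).inverse (prod H (iEmb T))).domain : Set (DSpace T)) ∧
        Dense (ran (prod (jEmb (T†)).inverse (prod H (iEmb T))) : Set (RSpace (T†))) ∧
        (∀ x : (prod (jEmb (T†)).inverse (prod H (iEmb T))).domain,
          ‖prod (jEmb (T†)).inverse (prod H (iEmb T)) x‖ = ‖(x : DSpace T)‖) ∧
        IsUniqueUnitaryExtension (prod (jEmb (T†)).inverse (prod H (iEmb T))) H' ∧
        H' = A'.symm) ∧
      -- the factorizations `T⁻¹ = i_T V` and `T* = j_{T*} U`, and `H' = U V⁻¹`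
      ((∃! V : 𝓖 ≃ₗᵢ[ℂ] DSpace T, T.inverse = prod (iEmb T) (ofUnitary V)) ∧
        (∃! U : 𝓖 ≃ₗᵢ[ℂ] RSpace (T†), T† = prod (jEmb (T†)) (ofUnitary U)) ∧
        ∀ (V : 𝓖 ≃ₗᵢ[ℂ] DSpace T) (U : 𝓖 ≃ₗᵢ[ℂ] RSpace (T†)),
          T.inverse = prod (iEmb T) (ofUnitary V) → T† = prod (jEmb (T†)) (ofUnitary U) →
            H' = V.symm.trans U) ∧
      -- `Θ`, and the variational formula; the conjugate dual of `𝓓(T)` consists of the bounded conjugate linear functionals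
      ((∃ Θ : RSpace (T†) ≃ₗᵢ[ℂ] (DSpace T →L⋆[ℂ] ℂ),
          ∀ (α : RSpace (T†)) (x : DSpace T), Θ α x = inner ℂ x (A' α)) ∧
        ∀ y : (jEmb (T†)).domain,
          BddAbove {r : ℝ | ∃ x : T.domain, x ≠ 0 ∧ r = ‖inner ℂ (x : 𝓗) (jEmb (T†) y)‖ / ‖T x‖} ∧
          ‖(y : RSpace (T†))‖ =
            sSup {r : ℝ | ∃ x : T.domain, x ≠ 0 ∧
              r = ‖inner ℂ (x : 𝓗) (jEmb (T†) y)‖ / ‖T x‖}) := by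
  have hT0 : LinearMap.ker T.toFun = ⊥ := by
    refine ker_eq_bot_iff_graph.2 fun x hx => ?_
    refine ker_eq_bot_iff_graph.1 hHker x ?_
    rw [hHT]
    exact mem_graph_prod.2 ⟨0, hx, (T†).graph.zero_mem⟩
  subst hHT
  obtain ⟨V, hV⟩ := exists_unitary_iEmb hTran hT0
  obtain ⟨U, hU⟩ := exists_unitary_jEmb (CloseEmb.dense_domain_adjoint hTclosed hTdense)
    (ker_adjoint_eq_bot hTdense hTran)
  have h : Factorizes T (iEmb T) (jEmb (T†)) V U :=
    ⟨hTclosed, hTdense, hTran, hT0, hV _ _, hU _ _⟩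
  refine ⟨⟨h.isCloseEmbedding_i, by rwa [h.ran_i], h.kernelOperator_i_eq hHker⟩,
    ⟨h.isCloseEmbedding_inverse_j, h.dense_ran_inverse_j, h.unitarilyEquivalent_kernelOperator⟩,
    U.symm.trans V, V.symm.trans U,
    ⟨h.ran_adjoint_le_domain_adjoint_i, h.extension_adjoint_i, h.domain_kernelOperator_i_le,
      h.ran_kernelOperator_i_le, h.extension_kernelOperator_i⟩,
    ⟨?_, ?_, h.dense_domain_prod_inverse_j_i, h.dense_ran_prod_inverse_j_i,
      h.norm_prod_inverse_j_i, h.extension_prod_inverse_j_i, rfl⟩,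
    ⟨⟨V, (h.inverse_eq_prod_i_iff V).2 rfl, fun V' => (h.inverse_eq_prod_i_iff V').1⟩,
      ⟨U, (h.adjoint_eq_prod_j_iff U).2 rfl, fun U' => (h.adjoint_eq_prod_j_iff U').1⟩, ?_⟩,
    exists_conjDual_isometry _, fun y => ?_⟩
  · intro x hx
    obtain ⟨z, hz⟩ := mem_domain_iff_exists.1 hx
    obtain ⟨y, h1, -⟩ := mem_graph_prod.1 hz
    exact mem_domain_iff_exists.2 ⟨y, h1⟩
  · intro z hz
    obtain ⟨x, hx⟩ := mem_ran_iff_exists.1 hz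
    obtain ⟨y, -, h1⟩ := mem_graph_prod.1 hx
    exact mem_ran_iff_exists.2 ⟨y, h1⟩
  · intro V' U' hV' hU'
    rw [(h.inverse_eq_prod_i_iff V').1 hV', (h.adjoint_eq_prod_j_iff U').1 hU']
  -- With `g = U⁻¹ y`, the norm of `y` is `‖g‖` and `j_{T*} y = T* g`.
  · rw [← U.symm.norm_map]
    exact norm_eq_sSup_quotient hTdense hTran hT0 (h.graph_j.1 ((jEmb (T†)).mem_graph y))
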